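/- Let $V$ be a complex Hilbert space of finite dimension, with inner product $\langle\cdot|\cdot\rangle$ antilinear in the first variable. Let $SV=\bigoplus_{d\ge 0}S^dV$ be its symmetric algebra with the canonical inner product, for which the summands $S^dV$ are mutually perpendicular, $\mathbf 1\in S^0V$ is a unit vector, and $\langle x_1\cdots x_d|y_1\cdots y_d\rangle=\sum_p\prod_{j}\langle x_j|y_{p(j)}\rangle$, where $p$ runs over the permutations of $\{1,\dots,d\}$. Let $SV'$ be the space of all antilinear functionals $SV\to\mathbb C$, in which $SV$ is embedded by $\phi\mapsto\langle\cdot|\phi\rangle$; for $\Phi\in SV'$ let $\Phi_d\in S^dV$ be the vector that represents the restriction of $\Phi$ to $S^dV$, i.e. $\Phi(\theta)=\langle\theta|\Phi_d\rangle$ for all $\theta\in S^dV$. For $\Phi,\Psi\in SV'$ and $0<t<1$ put $\langle\Phi:\Psi\rangle_t=\sum_{d\ge0}\langle\Phi_d|\Psi_d\rangle t^{2d}$ whenever the series converges, and let the extended bosonic pairing be $\langle\Phi:\Psi\rangle=\lim_{t\uparrow1}\langle\Phi:\Psi\rangle_t$ whenever this limit exists. To an antilinear map $Z:V\to V$ that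 is symmetric, i.e. $\langle y|Zx\rangle=\langle x|Zy\rangle$ for all $x,y\in V$, corresponds the unique $\zeta\in S^2V$ with $\langle y|Zx\rangle=\langle xy|\zeta\rangle$ for all $x,y\in V$, and the Gaussian $e^Z=\sum_{d\ge0}\zeta^d/d!\in SV'$. Let $\overline{\mathcal D}(V)$ be the set of symmetric antilinear maps $Z:V\to V$ of operator norm $\|Z\|\le1$. Let $\mathcal G(V)$ be the set of complex-linear maps $T:V\to V$ such that $\mathrm{Re}\langle v|Tv\rangle>0$ for all $0\ne v\in V$, and let $\mathrm{Det}^{1/2}:\mathcal G(V)\to\mathbb C$ be the holomorphic square root of the determinant with $\mathrm{Det}^{1/2}(I)=1$. Theorem. If $X,Y\in\overline{\mathcal D}(V)$ are such that $I-YX$ is invertible, then $I-YX\in\mathcal G(V)$, the extended bosonic pairing $\langle e^X:e^Y\rangle$ is defined, and $$\langle e^X:e^Y\rangle=\mathrm{Det}^{1/2}(I-YX)^{-1}.$$ -/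

import Mathlib

open scoped ComplexConjugate InnerProductSpace Topology
open Filter

namespace BosonicPairing


noncomputable section

section
variable {m : ℕ}

theorem sum_support_eq {p q : MvPolynomial (Fin m) ℂ} {s : Finset (Fin m →₀ ℕ)}
    (hs : p.support ⊆ s) :
    ∑ D ∈ p.support, ((∏ i, (D i).factorial : ℕ) : ℂ) * (conj (p.coeff D) * q.coeff D) =
      ∑ D ∈ s, ((∏ i, (D i).factorial : ℕ) : ℂ) * (conj (p.coeff D) * q.coeff D) := by
  refine Finset.sum_subset hs fun D _ hD => ?_
  rw [MvPolynomial.notMem_support_iff.1 hD]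
  simp

variable (m) in
/-- The sesquilinear form on polynomials for which distinct monomials are orthogonal and
`X₁ ^ d₁ ⋯ Xₘ ^ dₘ` has square norm `d₁! ⋯ dₘ!`. -/
def polyInner : MvPolynomial (Fin m) ℂ →ₗ⋆[ℂ] MvPolynomial (Fin m) ℂ →ₗ[ℂ] ℂ :=
  LinearMap.mk₂'ₛₗ (starRingEnd ℂ) (RingHom.id ℂ)
    (fun p q => ∑ D ∈ p.support, ((∏ i, (D i).factorial : ℕ) : ℂ) * (conj (p.coeff D) * q.coeff D))
    (fun p p' q => by
      classical
      rw [sum_support_eq (p := p + p') MvPolynomial.support_add,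
        sum_support_eq (p := p) Finset.subset_union_left,
        sum_support_eq (p := p') Finset.subset_union_right, ← Finset.sum_add_distrib]
      refine Finset.sum_congr rfl fun D _ => ?_
      rw [MvPolynomial.coeff_add, map_add]
      ring)
    (fun c p q => by
      rw [sum_support_eq (p := c • p) (s := p.support) MvPolynomial.support_smul,
        Finset.smul_sum]
      refine Finset.sum_congr rfl fun D _ => ?_
      rw [MvPolynomial.coeff_smul, smul_eq_mul, map_mul, smul_eq_mul]
      ring)
    (fun p q q' => by
      rw [← Finset.sum_add_distrib]
      refine Finset.sum_congr rfl fun D _ => ?_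
      rw [MvPolynomial.coeff_add]
      ring)
    (fun c p q => by
      rw [Finset.smul_sum]
      refine Finset.sum_congr rfl fun D _ => ?_
      rw [MvPolynomial.coeff_smul, RingHom.id_apply, smul_eq_mul, smul_eq_mul]
      ring)

theorem polyInner_apply (p q : MvPolynomial (Fin m) ℂ) :
    polyInner m p q =
      ∑ D ∈ p.support, ((∏ i, (D i).factorial : ℕ) : ℂ) * (conj (p.coeff D) * q.coeff D) := rfl

theorem polyInner_monomial_left (D : Fin m →₀ ℕ) (a : ℂ) (q : MvPolynomial (Fin m) ℂ) :
    polyInner m (MvPolynomial.monomial D a) q =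
      ((∏ i, (D i).factorial : ℕ) : ℂ) * (conj a * q.coeff D) := by
  classical
  rw [polyInner_apply, sum_support_eq (s := {D}) MvPolynomial.support_monomial_subset]
  simp

theorem polyInner_monomial_right (D : Fin m →₀ ℕ) (a : ℂ) (p : MvPolynomial (Fin m) ℂ) :
    polyInner m p (MvPolynomial.monomial D a) =
      ((∏ i, (D i).factorial : ℕ) : ℂ) * (conj (p.coeff D) * a) := by
  classical
  rw [polyInner_apply, sum_support_eq (s := p.support ∪ {D}) Finset.subset_union_left,
    Finset.sum_eq_single D]
  · simp
  · intro D' _ h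
    simp [MvPolynomial.coeff_monomial, h.symm]
  · simp

theorem polyInner_X_mul (i : Fin m) (p q : MvPolynomial (Fin m) ℂ) :
    polyInner m (MvPolynomial.X i * p) q = polyInner m p (MvPolynomial.pderiv i q) := by
  induction p using MvPolynomial.induction_on' with
  | add p p' hp hp' => rw [mul_add, map_add, map_add, LinearMap.add_apply, hp, hp',
      LinearMap.add_apply]
  | monomial D a =>
    rw [MvPolynomial.X, MvPolynomial.monomial_mul, polyInner_monomial_left,
      polyInner_monomial_left, MvPolynomial.coeff_pderiv, one_mul, add_comm (Finsupp.single i 1) D]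
    have h : (∏ j, ((D + Finsupp.single i 1 : Fin m →₀ ℕ) j).factorial) = (D i + 1) * ∏ j, (D j).factorial := by
      rw [← Finset.mul_prod_erase _ _ (Finset.mem_univ i),
        ← Finset.mul_prod_erase Finset.univ (fun j => (D j).factorial) (Finset.mem_univ i), ← mul_assoc]
      congr 1
      · simp [Nat.factorial_succ]
      · refine Finset.prod_congr rfl fun j hj => ?_
        simp [(Finset.ne_of_mem_erase hj).symm]
    rw [h]
    push_cast
    ring

theorem polyInner_conj_symm (p q : MvPolynomial (Fin m) ℂ) :
    conj (polyInner m q p) = polyInner m p q := by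
  classical
  rw [polyInner_apply, polyInner_apply, sum_support_eq (s := p.support ∪ q.support)
    Finset.subset_union_left, sum_support_eq (s := p.support ∪ q.support)
    Finset.subset_union_right, map_sum]
  refine Finset.sum_congr rfl fun D _ => ?_
  simp only [map_mul, Complex.conj_natCast, Complex.conj_conj]
  ring

theorem polyInner_self (p : MvPolynomial (Fin m) ℂ) :
    polyInner m p p =
      ((∑ D ∈ p.support, ((∏ i, (D i).factorial : ℕ) : ℝ) * ‖p.coeff D‖ ^ 2 : ℝ) : ℂ) := by
  rw [polyInner_apply]
  push_cast
  refine Finset.sum_congr rfl fun D _ => ?_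
  rw [Complex.conj_mul']

theorem polyInner_self_pos {p : MvPolynomial (Fin m) ℂ} (hp : p ≠ 0) :
    0 < (polyInner m p p).re := by
  rw [polyInner_self, Complex.ofReal_re]
  refine Finset.sum_pos (fun D hD => ?_) (MvPolynomial.support_nonempty.2 hp)
  have h1 : 0 < ‖p.coeff D‖ := norm_pos_iff.2 (MvPolynomial.mem_support_iff.1 hD)
  have h2 : 0 < ∏ i, (D i).factorial := Finset.prod_pos fun i _ => Nat.factorial_pos _
  positivity

theorem polyInner_eq_zero_of_isHomogeneous {p q : MvPolynomial (Fin m) ℂ} {k : ℕ}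
    (hq : q.IsHomogeneous k) (hp : ∀ D ∈ p.support, D.degree ≠ k) :
    polyInner m p q = 0 := by
  rw [polyInner_apply]
  refine Finset.sum_eq_zero fun D hD => ?_
  rw [hq.coeff_eq_zero (hp D hD)]
  simp

end

section
variable (V : Type*) [NormedAddCommGroup V] [InnerProductSpace ℂ V] [FiniteDimensional ℂ V]

/-- The coordinates `SV ≃ ℂ[X₁, …, Xₘ]` given by a unitary basis of `V`. -/
def coord : SymmetricAlgebra ℂ V ≃ₐ[ℂ] MvPolynomial (Fin (Module.finrank ℂ V)) ℂ :=
  SymmetricAlgebra.equivMvPolynomial (stdOrthonormalBasis ℂ V).toBasis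

/-- The canonical inner product on `SV`, antilinear in its first argument. -/
def symInner : SymmetricAlgebra ℂ V →ₗ⋆[ℂ] SymmetricAlgebra ℂ V →ₗ[ℂ] ℂ :=
  LinearMap.mk₂'ₛₗ (starRingEnd ℂ) (RingHom.id ℂ)
    (fun φ ψ => polyInner _ (coord V φ) (coord V ψ))
    (by simp) (by simp) (by simp) (by simp)

/-- The homogeneous summand `S^d V` of the symmetric algebra. -/
def symPow (d : ℕ) : Submodule ℂ (SymmetricAlgebra ℂ V) :=
  LinearMap.range (SymmetricAlgebra.ι ℂ V) ^ d

variable {V}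

theorem symInner_apply (φ ψ : SymmetricAlgebra ℂ V) :
    symInner V φ ψ = polyInner _ (coord V φ) (coord V ψ) := rfl

theorem coord_ι (x : V) : coord V (SymmetricAlgebra.ι ℂ V x) =
    ∑ i, ⟪stdOrthonormalBasis ℂ V i, x⟫_ℂ • MvPolynomial.X i := by
  conv_lhs => rw [← (stdOrthonormalBasis ℂ V).sum_repr' x]
  simp only [map_sum, map_smul]
  refine Finset.sum_congr rfl fun i _ => ?_
  have := SymmetricAlgebra.equivMvPolynomial_ι_apply (stdOrthonormalBasis ℂ V).toBasis i
  rw [OrthonormalBasis.coe_toBasis] at this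
  rw [coord, this]

theorem symInner_conj_symm (φ ψ : SymmetricAlgebra ℂ V) :
    conj (symInner V ψ φ) = symInner V φ ψ := polyInner_conj_symm _ _

theorem symInner_self_pos {φ : SymmetricAlgebra ℂ V} (hφ : φ ≠ 0) :
    0 < (symInner V φ φ).re :=
  polyInner_self_pos (by simpa using hφ)

theorem symInner_one : symInner V 1 1 = 1 := by
  rw [symInner_apply, map_one, ← MvPolynomial.C_1, MvPolynomial.C_apply, polyInner_monomial_left]
  simp

/-- The annihilation derivation of a vector, in coordinates. -/
def annih (x : V) : Derivation ℂ (MvPolynomial (Fin (Module.finrank ℂ V)) ℂ)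
    (MvPolynomial (Fin (Module.finrank ℂ V)) ℂ) :=
  ∑ i, ⟪x, stdOrthonormalBasis ℂ V i⟫_ℂ • MvPolynomial.pderiv i

theorem annih_apply (x : V) (p : MvPolynomial (Fin (Module.finrank ℂ V)) ℂ) :
    annih x p = ∑ i, ⟪x, stdOrthonormalBasis ℂ V i⟫_ℂ • MvPolynomial.pderiv i p := by
  have h := map_sum (Derivation.coeFnAddMonoidHom (R := ℂ)
    (A := MvPolynomial (Fin (Module.finrank ℂ V)) ℂ)
    (M := MvPolynomial (Fin (Module.finrank ℂ V)) ℂ))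
    (fun i => ⟪x, stdOrthonormalBasis ℂ V i⟫_ℂ • MvPolynomial.pderiv i) Finset.univ
  have h2 := congrFun h p
  rw [Finset.sum_apply] at h2
  exact h2

theorem symInner_ι_mul (x : V) (φ ψ : SymmetricAlgebra ℂ V) :
    symInner V (SymmetricAlgebra.ι ℂ V x * φ) ψ =
      polyInner _ (coord V φ) (annih x (coord V ψ)) := by
  rw [symInner_apply, map_mul, coord_ι, Finset.sum_mul, map_sum, annih_apply]
  simp only [map_sum, LinearMap.sum_apply, smul_mul_assoc,
    map_smul, LinearMap.map_smulₛₗ, LinearMap.smul_apply, polyInner_X_mul,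
    inner_conj_symm]

theorem annih_ι (x y : V) : annih x (coord V (SymmetricAlgebra.ι ℂ V y)) =
    algebraMap ℂ _ ⟪x, y⟫_ℂ := by
  classical
  rw [coord_ι, annih_apply]
  simp only [map_sum, Derivation.map_smul, MvPolynomial.pderiv_X, Pi.single_apply, smul_ite,
    smul_zero, Finset.sum_ite_eq', Finset.mem_univ, if_true]
  rw [← OrthonormalBasis.sum_inner_mul_inner (stdOrthonormalBasis ℂ V) x y, map_sum]
  simp [Algebra.smul_def]

theorem annih_prod (x : V) (n : ℕ) (z : Fin n → V) :
    annih x (∏ j, coord V (SymmetricAlgebra.ι ℂ V (z j))) =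
    ∑ k, ⟪x, z k⟫_ℂ •
      ∏ j ∈ Finset.univ.erase k, coord V (SymmetricAlgebra.ι ℂ V (z j)) := by
  generalize (Finset.univ : Finset (Fin n)) = s
  induction s using Finset.induction_on with
  | empty => simp
  | insert a s ha ih =>
    rw [Finset.prod_insert ha, Derivation.leibniz, ih, annih_ι, Finset.sum_insert ha,
      Finset.erase_insert ha, add_comm, Finset.smul_sum]
    congr 1
    · rw [smul_eq_mul, mul_comm, Algebra.smul_def]
    · refine Finset.sum_congr rfl fun k hk => ?_
      have hka : a ≠ k := fun h => ha (h ▸ hk)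
      rw [Finset.erase_insert_of_ne hka, Finset.prod_insert (by simp [ha]), smul_eq_mul,
        mul_smul_comm]

/-- The characteristic property of the inner product of the symmetric algebra. -/
theorem symInner_prod : ∀ (d : ℕ) (x y : Fin d → V),
    symInner V (∏ j, SymmetricAlgebra.ι ℂ V (x j)) (∏ j, SymmetricAlgebra.ι ℂ V (y j)) =
      ∑ p : Equiv.Perm (Fin d), ∏ j, ⟪x j, y (p j)⟫_ℂ
  | 0, x, y => by simp [symInner_one]
  | d + 1, x, y => by
    rw [Fin.prod_univ_succ, symInner_ι_mul, map_prod (coord V) (fun j => SymmetricAlgebra.ι ℂ V (y j)), annih_prod,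
      map_sum,
      ← Equiv.Perm.decomposeFin.symm.sum_comp, Fintype.sum_prod_type]
    refine Finset.sum_congr rfl fun k _ => ?_
    have h : ∏ j ∈ Finset.univ.erase k, coord V (SymmetricAlgebra.ι ℂ V (y j)) =
        coord V (∏ j : Fin d, SymmetricAlgebra.ι ℂ V (y (Equiv.swap 0 k j.succ))) := by
      rw [map_prod]
      refine Eq.trans ?_ (Finset.prod_map Finset.univ
        ((Fin.succEmb d).trans (Equiv.swap 0 k).toEmbedding)
        (fun j => coord V (SymmetricAlgebra.ι ℂ V (y j))))
      refine Finset.prod_congr ?_ fun _ _ => rfl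
      ext j
      simp only [Finset.mem_erase, Finset.mem_univ, and_true, Finset.mem_map, true_and]
      constructor
      · intro hj
        have h0 : Equiv.swap 0 k j ≠ 0 := fun h => hj (by
          rw [Equiv.swap_apply_eq_iff, Equiv.swap_apply_left] at h; exact h)
        obtain ⟨i, hi⟩ := Fin.exists_succ_eq.2 h0
        exact ⟨i, by simp [hi]⟩
      · rintro ⟨i, rfl⟩ h
        have : i.succ = 0 := by
          simpa [Equiv.swap_apply_eq_iff] using h
        exact Fin.succ_ne_zero _ this
    rw [map_smul, h, ← symInner_apply, symInner_prod d, smul_eq_mul, Finset.mul_sum]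
    refine Finset.sum_congr rfl fun e _ => ?_
    rw [Fin.prod_univ_succ]
    simp [Equiv.Perm.decomposeFin_symm_apply_zero, Equiv.Perm.decomposeFin_symm_apply_succ]

theorem mem_symPow_iff {d : ℕ} {φ : SymmetricAlgebra ℂ V} :
    φ ∈ symPow V d ↔ (coord V φ).IsHomogeneous d := by
  have h1 : (LinearMap.range (SymmetricAlgebra.ι ℂ V)).map (coord V).toAlgHom.toLinearMap =
      MvPolynomial.homogeneousSubmodule (Fin (Module.finrank ℂ V)) ℂ 1 := by
    rw [MvPolynomial.homogeneousSubmodule_one_eq_span_X]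
    apply le_antisymm
    · rintro _ ⟨_, ⟨x, rfl⟩, rfl⟩
      change coord V _ ∈ _
      rw [coord_ι]
      exact Submodule.sum_mem _ fun i _ => Submodule.smul_mem _ _
        (Submodule.subset_span ⟨i, rfl⟩)
    · rw [Submodule.span_le]
      rintro _ ⟨i, rfl⟩
      refine ⟨_, ⟨stdOrthonormalBasis ℂ V i, rfl⟩, ?_⟩
      have := SymmetricAlgebra.equivMvPolynomial_ι_apply (stdOrthonormalBasis ℂ V).toBasis i
      rw [OrthonormalBasis.coe_toBasis] at this
      exact this
  have h2 : (symPow V d).map (coord V).toAlgHom.toLinearMap =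
      MvPolynomial.homogeneousSubmodule (Fin (Module.finrank ℂ V)) ℂ d := by
    rw [symPow, Submodule.map_pow, h1, MvPolynomial.homogeneousSubmodule_one_pow]
  rw [← MvPolynomial.mem_homogeneousSubmodule, ← h2]
  constructor
  · exact fun h => ⟨φ, h, rfl⟩
  · rintro ⟨ψ, h, e⟩
    have : ψ = φ := (coord V).injective e
    exact this ▸ h

/-- Distinct homogeneous summands are perpendicular. -/
theorem symInner_of_mem_symPow {c d : ℕ} (h : c ≠ d) {φ ψ : SymmetricAlgebra ℂ V}
    (hφ : φ ∈ symPow V c) (hψ : ψ ∈ symPow V d) : symInner V φ ψ = 0 := by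
  rw [mem_symPow_iff] at hφ hψ
  refine polyInner_eq_zero_of_isHomogeneous hψ fun D hD hDd => h ?_
  rw [← hDd]
  by_contra hne
  exact MvPolynomial.mem_support_iff.1 hD (hφ.coeff_eq_zero (Ne.symm hne))

variable (V) in
/-- The full antidual `SV'`: all antilinear functionals on the symmetric algebra. -/
abbrev Antidual : Type _ := SymmetricAlgebra ℂ V →ₗ⋆[ℂ] ℂ

/-- The homogeneous component `Φ_d`, the restriction of `Φ` to `S^d V`, as an
element of `S^d V` (see `component_mem` and `component_spec`): the sum of `Φ(v^D) v^D` over the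
unitary basis vectors `v^D` of `S^d V`. -/
def component (Φ : Antidual V) (d : ℕ) : SymmetricAlgebra ℂ V :=
  ∑ D ∈ Finset.finsuppAntidiag Finset.univ d,
    (Φ ((coord V).symm (MvPolynomial.monomial D 1)) / ((∏ i, (D i).factorial : ℕ) : ℂ)) •
      (coord V).symm (MvPolynomial.monomial D 1)

theorem mem_finsuppAntidiag_univ {m d : ℕ} {D : Fin m →₀ ℕ} :
    D ∈ Finset.finsuppAntidiag Finset.univ d ↔ D.degree = d := by
  simp [Finset.mem_finsuppAntidiag, Finsupp.degree_eq_sum]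

theorem component_mem (Φ : Antidual V) (d : ℕ) : component Φ d ∈ symPow V d := by
  refine Submodule.sum_mem _ fun D hD => Submodule.smul_mem _ _ (mem_symPow_iff.2 ?_)
  rw [AlgEquiv.apply_symm_apply]
  exact MvPolynomial.isHomogeneous_monomial _ (mem_finsuppAntidiag_univ.1 hD)

theorem component_spec (Φ : Antidual V) {d : ℕ} {θ : SymmetricAlgebra ℂ V}
    (hθ : θ ∈ symPow V d) : Φ θ = symInner V θ (component Φ d) := by
  rw [mem_symPow_iff] at hθ
  have h : θ = ∑ D ∈ Finset.finsuppAntidiag Finset.univ d,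
      (coord V θ).coeff D • (coord V).symm (MvPolynomial.monomial D 1) := by
    apply (coord V).injective
    simp only [map_sum, map_smul, AlgEquiv.apply_symm_apply]
    conv_lhs => rw [MvPolynomial.as_sum (coord V θ)]
    have hsub : (coord V θ).support ⊆ Finset.finsuppAntidiag Finset.univ d := fun D hD => by
      rw [mem_finsuppAntidiag_univ]
      by_contra hne
      exact MvPolynomial.mem_support_iff.1 hD (hθ.coeff_eq_zero hne)
    rw [Finset.sum_subset hsub]
    · simp [MvPolynomial.smul_monomial]
    · intro D _ hD
      simp [MvPolynomial.notMem_support_iff.1 hD]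
  conv_lhs => rw [h]
  rw [component, map_sum, map_sum]
  refine Finset.sum_congr rfl fun D _ => ?_
  have hD : ((∏ i, (D i).factorial : ℕ) : ℂ) ≠ 0 :=
    Nat.cast_ne_zero.2 (Finset.prod_ne_zero_iff.2 fun i _ => Nat.factorial_ne_zero _)
  rw [LinearMap.map_smulₛₗ, map_smul, symInner_apply, AlgEquiv.apply_symm_apply,
    polyInner_monomial_right, smul_eq_mul, smul_eq_mul]
  field_simp

/-- Antilinear maps with the symmetry `⟨y | Z x⟩ = ⟨x | Z y⟩`. -/
def IsSymmetric (Z : V →L⋆[ℂ] V) : Prop := ∀ x y : V, ⟪y, Z x⟫_ℂ = ⟪x, Z y⟫_ℂ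

/-- The quadratic in `S² V` corresponding to a symmetric antilinear map (see `quadratic_spec`). -/
def quadratic (Z : V →L⋆[ℂ] V) : SymmetricAlgebra ℂ V :=
  (1 / 2 : ℂ) • ∑ k, SymmetricAlgebra.ι ℂ V (stdOrthonormalBasis ℂ V k) *
    SymmetricAlgebra.ι ℂ V (Z (stdOrthonormalBasis ℂ V k))

theorem quadratic_mem (Z : V →L⋆[ℂ] V) : quadratic Z ∈ symPow V 2 := by
  refine Submodule.smul_mem _ _ (Submodule.sum_mem _ fun k _ => ?_)
  rw [symPow, pow_two]
  exact Submodule.mul_mem_mul ⟨_, rfl⟩ ⟨_, rfl⟩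

theorem symInner_mul_mul (x y u v : V) :
    symInner V (SymmetricAlgebra.ι ℂ V x * SymmetricAlgebra.ι ℂ V y)
      (SymmetricAlgebra.ι ℂ V u * SymmetricAlgebra.ι ℂ V v) =
      ⟪x, u⟫_ℂ * ⟪y, v⟫_ℂ + ⟪x, v⟫_ℂ * ⟪y, u⟫_ℂ := by
  have := symInner_prod 2 ![x, y] ![u, v]
  simp only [Fin.prod_univ_two, Matrix.cons_val_zero, Matrix.cons_val_one] at this
  rw [this, ← Equiv.Perm.decomposeFin.symm.sum_comp, Fintype.sum_prod_type]
  simp [Fin.sum_univ_two, Equiv.Perm.decomposeFin_symm_apply_one]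

theorem quadratic_spec {Z : V →L⋆[ℂ] V} (hZ : IsSymmetric Z) (x y : V) :
    ⟪y, Z x⟫_ℂ =
      symInner V (SymmetricAlgebra.ι ℂ V x * SymmetricAlgebra.ι ℂ V y) (quadratic Z) := by
  have key : ∀ x y : V, ∑ k, ⟪x, stdOrthonormalBasis ℂ V k⟫_ℂ *
      ⟪y, Z (stdOrthonormalBasis ℂ V k)⟫_ℂ = ⟪y, Z x⟫_ℂ := by
    intro x y
    conv_rhs => rw [← (stdOrthonormalBasis ℂ V).sum_repr' x]
    simp only [map_sum, map_smulₛₗ, inner_sum, inner_smul_right, inner_conj_symm]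
  have hq := key y x
  simp only [quadratic, map_smul, map_sum, symInner_mul_mul, Finset.sum_add_distrib, key,
    smul_eq_mul]
  rw [Finset.sum_congr rfl fun k _ => mul_comm _ _, hq, ← hZ x y]
  ring

theorem quadratic_unique {Z : V →L⋆[ℂ] V} (hZ : IsSymmetric Z) {ζ : SymmetricAlgebra ℂ V}
    (hζ : ζ ∈ symPow V 2) (h : ∀ x y : V, ⟪y, Z x⟫_ℂ =
      symInner V (SymmetricAlgebra.ι ℂ V x * SymmetricAlgebra.ι ℂ V y) ζ) : ζ = quadratic Z := by
  by_contra hne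
  have h0 : ζ - quadratic Z ≠ 0 := sub_ne_zero.2 hne
  have hmem : ζ - quadratic Z ∈ symPow V 2 := Submodule.sub_mem _ hζ (quadratic_mem Z)
  have hz : ∀ θ ∈ symPow V 2, symInner V θ (ζ - quadratic Z) = 0 := by
    intro θ hθ
    rw [symPow, pow_two] at hθ
    induction hθ using Submodule.mul_induction_on' with
    | mem_mul_mem a ha b hb =>
      obtain ⟨x, rfl⟩ := ha
      obtain ⟨y, rfl⟩ := hb
      rw [map_sub, ← h, ← quadratic_spec hZ, sub_self]
    | add a _ b _ ha hb => rw [map_add, LinearMap.add_apply, ha, hb, add_zero]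
  have := symInner_self_pos h0
  rw [hz _ hmem] at this
  simp at this

theorem finite_support_pairing {ζ : SymmetricAlgebra ℂ V} (hζ : ζ ∈ symPow V 2)
    (θ : SymmetricAlgebra ℂ V) :
    (Function.support fun d : ℕ => symInner V θ ((d.factorial : ℂ)⁻¹ • ζ ^ d)).Finite := by
  refine (Set.finite_Iic (coord V θ).totalDegree).subset fun d hd => ?_
  by_contra hlt
  refine hd ?_
  have hlt : (coord V θ).totalDegree < d := not_le.1 hlt
  have hh : (coord V ((d.factorial : ℂ)⁻¹ • ζ ^ d)).IsHomogeneous (2 * d) := by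
    rw [← mem_symPow_iff]
    refine Submodule.smul_mem _ _ ?_
    have := Submodule.pow_mem_pow _ hζ d
    rwa [symPow, ← pow_mul] at this
  refine polyInner_eq_zero_of_isHomogeneous hh fun D hD => ?_
  have := MvPolynomial.le_totalDegree hD
  have h2 : D.degree = D.sum fun _ e => e := rfl
  omega

/-- The Gaussian `e^Z = ∑ ζ^d / d!` in `SV'`, each `ζ^d / d!` in `SV` being viewed as the
antifunctional `⟨· | ζ^d / d!⟩`; on every element of `SV` the sum is finite. -/
def gaussian (Z : V →L⋆[ℂ] V) : Antidual V where
  toFun θ := ∑ᶠ d : ℕ, symInner V θ ((d.factorial : ℂ)⁻¹ • quadratic Z ^ d)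
  map_add' θ θ' := by
    simp only [map_add, LinearMap.add_apply]
    exact finsum_add_distrib (finite_support_pairing (quadratic_mem Z) θ)
      (finite_support_pairing (quadratic_mem Z) θ')
  map_smul' c θ := by
    simp only [map_smulₛₗ (symInner V) c θ, LinearMap.smul_apply]
    exact (smul_finsum' (starRingEnd ℂ c) (finite_support_pairing (quadratic_mem Z) θ)).symm

/-- `⟨Φ : Ψ⟩_t` is defined and equal to `c`: the series `∑ ⟨Φ_d | Ψ_d⟩ t^{2d}` converges to `c`. -/
def HasPairingAt (t : ℝ) (Φ Ψ : Antidual V) (c : ℂ) : Prop :=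
  Tendsto (fun n : ℕ => ∑ d ∈ Finset.range n,
    symInner V (component Φ d) (component Ψ d) * (t : ℂ) ^ (2 * d)) atTop (𝓝 c)

/-- The extended bosonic pairing `⟨Φ : Ψ⟩` is defined and equal to `c`. -/
def HasPairing (Φ Ψ : Antidual V) (c : ℂ) : Prop :=
  ∃ f : ℝ → ℂ, (∀ t ∈ Set.Ioo (0 : ℝ) 1, HasPairingAt t Φ Ψ (f t)) ∧
    Tendsto f (𝓝[<] 1) (𝓝 c)

variable (V) in
/-- The closed Siegel domain. -/
def closedSiegel : Set (V →L⋆[ℂ] V) := {Z | IsSymmetric Z ∧ ‖Z‖ ≤ 1}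
end

section
variable (V : Type*) [NormedAddCommGroup V] [InnerProductSpace ℂ V] [FiniteDimensional ℂ V]

/-- The set of linear maps `T` with `Re ⟨v | T v⟩ > 0` for all `v ≠ 0`. -/
def posRe : Set (V →L[ℂ] V) := {T | ∀ v : V, v ≠ 0 → 0 < (⟪v, T v⟫_ℂ).re}

/-- `r` is on `posRe V` a holomorphic square root of the determinant, normalized by `r(I) = 1`
(see `exists_isDetSqrt` and `IsDetSqrt.eqOn` for existence and uniqueness). -/
structure IsDetSqrt (r : (V →L[ℂ] V) → ℂ) : Prop where
  differentiableOn : DifferentiableOn ℂ r (posRe V)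
  sq_eq : ∀ T ∈ posRe V, r T ^ 2 = T.det
  map_one : r 1 = 1

variable {V}

theorem one_mem_posRe : (1 : V →L[ℂ] V) ∈ posRe V := fun v hv => by
  have h : 0 < ‖v‖ := norm_pos_iff.2 hv
  rw [one_apply_eq_self, inner_self_eq_norm_sq_to_K (𝕜 := ℂ) v]
  have : (((‖v‖ : ℂ) ^ 2)).re = ‖v‖ ^ 2 := by norm_cast
  exact this ▸ by positivity

theorem convex_posRe : Convex ℝ (posRe V) := fun S hS T hT a b ha hb hab v hv => by
  have h1 := hS v hv
  have h2 := hT v hv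
  simp only [add_apply, smul_apply, inner_add_right,
    inner_smul_right_eq_smul, Complex.add_re, Complex.real_smul, Complex.re_ofReal_mul]
  rcases ha.eq_or_lt with rfl | ha
  · have : b = 1 := by linarith
    subst this; simpa using h2
  · have := mul_pos ha h1
    have := mul_nonneg hb h2.le
    linarith

theorem isOpen_posRe : IsOpen (posRe V) := by
  have : posRe V = {T | ∀ v ∈ Metric.sphere (0 : V) 1, 0 < (⟪v, T v⟫_ℂ).re} := by
    ext T
    refine ⟨fun h v hv => h v ?_, fun h v hv => ?_⟩
    · rintro rfl; simp at hv
    · have h1 := h ((‖v‖⁻¹ : ℝ) • v) (by simp [norm_smul, hv])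
      have hT : T ((‖v‖⁻¹ : ℝ) • v) = (‖v‖⁻¹ : ℝ) • T v := map_real_smul T.toAddMonoidHom T.continuous _ _
      rw [hT] at h1
      simp only [inner_smul_left_eq_smul, inner_smul_right_eq_smul, Complex.real_smul,
        Complex.re_ofReal_mul] at h1
      have h2 : 0 < ‖v‖⁻¹ := by positivity
      exact pos_of_mul_pos_right (pos_of_mul_pos_right h1 h2.le) h2.le
  rw [this, isOpen_iff_mem_nhds]
  intro T hT
  refine (isCompact_sphere (0 : V) 1).eventually_forall_of_forall_eventually fun v hv => ?_
  have hc : Continuous fun p : (V →L[ℂ] V) × V => (⟪p.2, p.1 p.2⟫_ℂ).re := by fun_prop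
  exact hc.continuousAt.eventually (lt_mem_nhds (hT v hv))

theorem det_ne_zero_of_mem_posRe {T : V →L[ℂ] V} (hT : T ∈ posRe V) : T.det ≠ 0 := by
  intro h
  have := LinearMap.bot_lt_ker_of_det_eq_zero (f := (T : V →ₗ[ℂ] V)) h
  obtain ⟨v, hv, hv0⟩ := (Submodule.ne_bot_iff _).1 this.ne'
  have h1 := hT v hv0
  have h2 : T v = 0 := hv
  simp [h2] at h1

theorem contDiff_det : ContDiff ℂ 2 (fun T : V →L[ℂ] V => T.det) := by
  let b := Module.finBasis ℂ V
  have h : (fun T : V →L[ℂ] V => T.det) = fun T => ∑ σ : Equiv.Perm (Fin (Module.finrank ℂ V)),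
      ((Equiv.Perm.sign σ : ℤ) : ℂ) * ∏ i, b.repr (T (b i)) (σ i) := by
    funext T
    rw [ContinuousLinearMap.det, ← LinearMap.det_toMatrix b, Matrix.det_apply']
    simp [LinearMap.toMatrix_apply]
  rw [h]
  refine ContDiff.sum fun σ _ => contDiff_const.mul (contDiff_prod fun i _ => ?_)
  let l : V →ₗ[ℂ] ℂ := b.coord (σ i)
  have : ContDiff ℂ 2 fun T : V →L[ℂ] V => l.toContinuousLinearMap (T (b i)) := by fun_prop
  exact this

theorem exists_isDetSqrt : ∃ r, IsDetSqrt V r := by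
  let ω : (V →L[ℂ] V) → (V →L[ℂ] V) →L[ℂ] ℂ := fun T => (T.det)⁻¹ • fderiv ℂ (fun S : V →L[ℂ] V => S.det) T
  have key : ∀ T ∈ posRe V, ∃ dω : (V →L[ℂ] V) →L[ℂ] (V →L[ℂ] V) →L[ℂ] ℂ, HasFDerivAt ω dω T ∧ ∀ x y, dω x y = dω y x := by
    intro T hT
    have h0 := det_ne_zero_of_mem_posRe hT
    let g : (V →L[ℂ] V) → ℂ := fun S => Complex.log (S.det / T.det)
    have hg : ContDiffAt ℂ 2 g T := by
      exact (Complex.contDiffAt_log (by simp [div_self h0])).comp T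
        (contDiff_det.contDiffAt.div_const _)
    have hev : fderiv ℂ g =ᶠ[𝓝 T] ω := by
      have hc : ContinuousAt (fun S : V →L[ℂ] V => S.det / T.det) T :=
        (contDiff_det.continuous.div_const _).continuousAt
      have : ∀ᶠ S in 𝓝 T, S.det / T.det ∈ Complex.slitPlane :=
        hc.eventually (Complex.isOpen_slitPlane.mem_nhds (by simp [div_self h0]))
      filter_upwards [this] with S hS
      have hd : HasFDerivAt (fun S : V →L[ℂ] V => S.det / T.det)
          ((T.det)⁻¹ • fderiv ℂ (fun S : V →L[ℂ] V => S.det) S) S := by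
        have := ((contDiff_det (V := V)).differentiable (by simp) S).hasFDerivAt.const_mul (T.det)⁻¹
        simpa [div_eq_inv_mul] using this
      have h3 := (hd.clog hS).fderiv
      refine h3.trans ?_
      have : (S.det / T.det)⁻¹ * (T.det)⁻¹ = (S.det)⁻¹ := by field_simp
      rw [smul_smul, this]
    have hs : IsSymmSndFDerivAt ℂ g T := hg.isSymmSndFDerivAt (by simp)
    refine ⟨fderiv ℂ (fderiv ℂ g) T, ?_, fun x y => hs x y⟩
    have : DifferentiableAt ℂ (fderiv ℂ g) T :=
      (hg.fderiv_right (m := 1) (by norm_num)).differentiableAt (by simp)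
    exact this.hasFDerivAt.congr_of_eventuallyEq hev.symm
  choose! dω hdω hsym using key
  obtain ⟨f, hf⟩ := (convex_posRe (V := V)).exists_forall_hasFDerivWithinAt_of_hasFDerivWithinAt_symmetric
    (ω := ω) (dω := fun T => (dω T).restrictScalars ℝ)
    (fun T hT => ((hdω T hT).restrictScalars ℝ).hasFDerivWithinAt)
    (fun T hT x _ y _ => hsym T hT x y)
  have hdet : ∀ T ∈ posRe V, HasFDerivWithinAt (fun S : V →L[ℂ] V => S.det) (T.det • ω T) (posRe V) T := by
    intro T hT
    have := ((contDiff_det (V := V)).differentiable (by simp) T).hasFDerivAt.hasFDerivWithinAt (s := posRe V)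
    simpa [ω, smul_smul, mul_inv_cancel₀ (det_ne_zero_of_mem_posRe hT)] using this
  have hE : ∀ T ∈ posRe V, HasFDerivWithinAt (fun S : V →L[ℂ] V => Complex.exp (-(f S)) * S.det)
      (0 : (V →L[ℂ] V) →L[ℂ] ℂ) (posRe V) T := by
    intro T hT
    have := ((hf T hT).fun_neg.cexp).mul (hdet T hT)
    refine this.congr_fderiv ?_
    ext x
    simp; ring
  have hone := one_mem_posRe (V := V)
  have hconst : ∀ T ∈ posRe V, Complex.exp (-(f T)) * T.det = Complex.exp (-(f 1)) := by
    intro T hT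
    have := (convex_posRe (V := V)).is_const_of_fderivWithin_eq_zero (𝕜 := ℂ)
      (fun S hS => (hE S hS).differentiableWithinAt)
      (fun S hS => (hE S hS).fderivWithin (isOpen_posRe.uniqueDiffWithinAt hS)) hT hone
    simpa [ContinuousLinearMap.det] using this
  refine ⟨fun T => Complex.exp ((f T - f 1) * (1 / 2)), ?_, ?_, by simp⟩
  · intro T hT
    exact (((hf T hT).differentiableWithinAt.sub_const (f 1)).mul_const (1 / 2)).cexp
  · intro T hT
    have := hconst T hT
    rw [← Complex.exp_nat_mul]
    have h2 : ((2:ℕ):ℂ) * ((f T - f 1) * (1 / 2)) = f T + -(f 1) := by push_cast; ring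
    rw [h2, Complex.exp_add, ← this, ← mul_assoc, ← Complex.exp_add]
    simp

theorem IsDetSqrt.eqOn {r s : (V →L[ℂ] V) → ℂ} (hr : IsDetSqrt V r) (hs : IsDetSqrt V s) :
    Set.EqOn r s (posRe V) := by
  refine (convex_posRe (V := V)).isPreconnected.eq_of_sq_eq hr.differentiableOn.continuousOn
    hs.differentiableOn.continuousOn (fun T hT => ?_) (fun {T} hT h => ?_) one_mem_posRe
    (hr.map_one.trans hs.map_one.symm)
  · simp [hr.sq_eq T hT, hs.sq_eq T hT]
  · have := hs.sq_eq T hT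
    rw [h] at this
    exact det_ne_zero_of_mem_posRe hT (by simpa using this.symm)

variable (V) in
/-- The holomorphic square root `Det^{1/2}` on `posRe V` with `Det^{1/2}(I) = 1`. -/
def detSqrt : (V →L[ℂ] V) → ℂ := Classical.choose (exists_isDetSqrt (V := V))

theorem isDetSqrt_detSqrt : IsDetSqrt V (detSqrt V) := Classical.choose_spec exists_isDetSqrt
end

end

end BosonicPairing

/-!
The coefficient `aₙ = ⟨ξⁿ / n! | ηⁿ / n!⟩` of `⟨e^X : e^Y⟩_t = ∑ aₙ t^{4n}` satisfies a recursion.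
Multiplication by a vector `v` is adjoint to the derivation that annihilates `v`, and this
derivation carries `ζⁿ⁺¹ / (n+1)!` to `(Zv) ζⁿ / n!`. Writing `η = ½ ∑ eₖ (Y eₖ)` and moving vectors
across the inner product until none is left gives, with `T = YX`,
`(n+1) aₙ₊₁ = ½ ∑_{i+j=n} tr(Tⁱ⁺¹) aⱼ`.

On the other side, Jacobi's formula shows that `F(z) = Det^{1/2}(I - zT)⁻¹` solves
`F' = ½ tr(T (I - zT)⁻¹) F`, so that its Taylor coefficients satisfy the same recursion. As `F` is
holomorphic in the unit disc, its Taylor series converges there, whence `⟨e^X : e^Y⟩_t = F(t⁴)`;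
if `I - T` lies in the domain of `Det^{1/2}` as well, then `F` is continuous at `1`.
-/

namespace BosonicPairing

noncomputable section

open Finset.HasAntidiagonal (antidiagonal)

theorem inv_factorial_succ_mul {K : Type*} [Field K] [CharZero K] (n : ℕ) :
    ((n + 1).factorial : K)⁻¹ * ((n : K) + 1) = (n.factorial : K)⁻¹ := by
  have hn : (n : K) + 1 ≠ 0 := Nat.cast_add_one_ne_zero n
  rw [Nat.factorial_succ]
  push_cast
  field_simp

section LinearODE

open FormalMultilinearSeries (ofScalars)

variable {𝕜 : Type*} [NontriviallyNormedField 𝕜] [CharZero 𝕜]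

theorem iteratedDeriv_mul_div_factorial {f g : 𝕜 → 𝕜} {x : 𝕜} {n : ℕ}
    (hf : ContDiffAt 𝕜 n f x) (hg : ContDiffAt 𝕜 n g x) :
    iteratedDeriv n (f * g) x / n.factorial = ∑ ij ∈ antidiagonal n,
      iteratedDeriv ij.1 f x / ij.1.factorial * (iteratedDeriv ij.2 g x / ij.2.factorial) := by
  rw [iteratedDeriv_mul hf hg, Finset.Nat.sum_antidiagonal_eq_sum_range_succ_mk, Finset.sum_div]
  refine Finset.sum_congr rfl fun i hi => ?_
  rw [Nat.cast_choose 𝕜 (Nat.lt_succ_iff.1 (Finset.mem_range.1 hi))]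
  field_simp [Nat.factorial_ne_zero]

variable [CompleteSpace 𝕜]

theorem iteratedDeriv_div_factorial_eq {g : 𝕜 → 𝕜} {c : ℕ → 𝕜} {x : 𝕜}
    (hg : HasFPowerSeriesAt g (ofScalars 𝕜 c) x) (n : ℕ) :
    iteratedDeriv n g x / n.factorial = c n := by
  have h := hg.analyticAt.hasFPowerSeriesAt.eq_formalMultilinearSeries hg
  exact congrFun (FormalMultilinearSeries.ofScalars_series_injective 𝕜 𝕜 h) n

theorem succ_mul_iteratedDeriv_div_factorial_of_deriv_eq_mul {f g : 𝕜 → 𝕜} {c : ℕ → 𝕜} {x : 𝕜}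
    (hf : AnalyticAt 𝕜 f x) (hg : HasFPowerSeriesAt g (ofScalars 𝕜 c) x)
    (hfg : deriv f =ᶠ[𝓝 x] g * f) (n : ℕ) :
    ((n : 𝕜) + 1) * (iteratedDeriv (n + 1) f x / (n + 1).factorial) =
      ∑ ij ∈ antidiagonal n, c ij.1 * (iteratedDeriv ij.2 f x / ij.2.factorial) := by
  calc ((n : 𝕜) + 1) * (iteratedDeriv (n + 1) f x / (n + 1).factorial)
      = iteratedDeriv n (g * f) x / n.factorial := by
        rw [iteratedDeriv_succ', hfg.iteratedDeriv_eq, div_eq_mul_inv, div_eq_mul_inv,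
          ← inv_factorial_succ_mul n]
        ring
    _ = _ := by
        rw [iteratedDeriv_mul_div_factorial hg.analyticAt.contDiffAt hf.contDiffAt]
        simp only [iteratedDeriv_div_factorial_eq hg]

theorem eq_of_succ_mul_eq_sum_antidiagonal {K : Type*} [Field K] [CharZero K] {a b c : ℕ → K}
    (h0 : a 0 = b 0)
    (ha : ∀ n : ℕ, ((n : K) + 1) * a (n + 1) = ∑ ij ∈ antidiagonal n, c ij.1 * a ij.2)
    (hb : ∀ n : ℕ, ((n : K) + 1) * b (n + 1) = ∑ ij ∈ antidiagonal n, c ij.1 * b ij.2)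
    (n : ℕ) : a n = b n := by
  induction n using Nat.strong_induction_on with
  | _ n ih =>
    cases n with
    | zero => exact h0
    | succ n =>
      refine mul_left_cancel₀ (Nat.cast_add_one_ne_zero n) ?_
      rw [ha, hb]
      refine Finset.sum_congr rfl fun ij hij => ?_
      rw [ih ij.2 (Finset.Nat.antidiagonal.snd_lt hij)]

theorem hasSum_of_hasDerivAt_mul {f g : ℂ → ℂ} {a c : ℕ → ℂ} {x z : ℂ} {R : ℝ}
    (hf : ∀ w ∈ Metric.ball x R, HasDerivAt f (g w * f w) w)
    (hg : HasFPowerSeriesAt g (ofScalars ℂ c) x) (h0 : a 0 = f x)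
    (ha : ∀ n : ℕ, ((n : ℂ) + 1) * a (n + 1) = ∑ ij ∈ antidiagonal n, c ij.1 * a ij.2)
    (hz : z ∈ Metric.ball x R) : HasSum (fun n => a n * (z - x) ^ n) (f z) := by
  have hball : Metric.ball x R ∈ 𝓝 x := Metric.ball_mem_nhds x (Metric.pos_of_mem_ball hz)
  have hdiff : DifferentiableOn ℂ f (Metric.ball x R) := fun w hw =>
    (hf w hw).differentiableAt.differentiableWithinAt
  have hderiv : deriv f =ᶠ[𝓝 x] g * f := by
    filter_upwards [hball] with w hw using (hf w hw).deriv
  have hcoeff : ∀ n, a n = iteratedDeriv n f x / n.factorial :=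
    eq_of_succ_mul_eq_sum_antidiagonal (by simp [h0]) ha
      (succ_mul_iteratedDeriv_div_factorial_of_deriv_eq_mul (hdiff.analyticAt hball) hg hderiv)
  refine (Complex.hasSum_taylorSeries_on_ball hdiff hz).congr_fun fun n => ?_
  rw [hcoeff, smul_eq_mul, smul_eq_mul, div_mul_eq_mul_div, div_eq_inv_mul,
    mul_comm (iteratedDeriv n f x)]

end LinearODE

section Resolvent

variable {𝕜 A : Type*} [NontriviallyNormedField 𝕜] [NormedRing A] [NormedAlgebra 𝕜 A]
  [HasSummableGeomSeries A]

theorem hasFPowerSeriesAt_clm_inverse_one_sub_smul (ℓ : A →L[𝕜] 𝕜) (a : A) :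
    HasFPowerSeriesAt (fun z : 𝕜 => ℓ (Ring.inverse (1 - z • a)))
      (FormalMultilinearSeries.ofScalars 𝕜 fun n => ℓ (a ^ n)) 0 := by
  have h := (ℓ.comp_hasFPowerSeriesOnBall
    (spectrum.hasFPowerSeriesOnBall_inverse_one_sub_smul 𝕜 a)).hasFPowerSeriesAt
  rw [hasFPowerSeriesAt_iff] at h ⊢
  refine h.mono fun z hz => hz.congr_fun fun n => ?_
  rw [FormalMultilinearSeries.coeff_ofScalars]
  change z ^ n • ℓ (a ^ n) = z ^ n • ℓ (ContinuousMultilinearMap.mkPiRing 𝕜 (Fin n) (a ^ n) 1)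
  simp only [ContinuousMultilinearMap.mkPiRing_apply, Pi.one_apply, Finset.prod_const_one, one_smul]

end Resolvent

section Determinant

variable {𝕜 E : Type*} [NontriviallyNormedField 𝕜] [AddCommGroup E] [Module 𝕜 E]
  [FiniteDimensional 𝕜 E]

theorem hasDerivAt_det_one_add_smul (M : Module.End 𝕜 E) :
    HasDerivAt (fun w : 𝕜 => LinearMap.det (1 + w • M)) (LinearMap.trace 𝕜 E M) 0 := by
  let b := Module.finBasis 𝕜 E
  let A := LinearMap.toMatrix b b M
  let q := (Matrix.det (1 + (Polynomial.X : Polynomial 𝕜) • A.map Polynomial.C)).divX.divX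
  have hexpand : (fun w : 𝕜 => LinearMap.det (1 + w • M)) =
      fun w => 1 + LinearMap.trace 𝕜 E M * w + q.eval w * w ^ 2 := by
    funext w
    rw [← LinearMap.det_toMatrix b, LinearMap.trace_eq_matrix_trace 𝕜 b, ← Matrix.det_one_add_smul]
    simp only [map_add, map_smul, LinearMap.toMatrix_one]
  rw [hexpand]
  refine ((((hasDerivAt_id (0 : 𝕜)).const_mul (LinearMap.trace 𝕜 E M)).const_add 1).add
    ((q.hasDerivAt 0).mul ((hasDerivAt_id (0 : 𝕜)).pow 2))).congr_deriv ?_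
  simp

theorem hasDerivAt_det_one_sub_smul {T R : Module.End 𝕜 E} {z : 𝕜} (hR : R * (1 - z • T) = 1) :
    HasDerivAt (fun w : 𝕜 => LinearMap.det (1 - w • T))
      (-(LinearMap.det (1 - z • T) * LinearMap.trace 𝕜 E (T * R))) z := by
  have hfactor : ∀ w : 𝕜, 1 - w • T = (1 + (w - z) • -(T * R)) * (1 - z • T) := by
    intro w
    rw [add_mul, smul_mul_assoc, neg_mul, mul_assoc, hR, mul_one, one_mul, sub_smul, smul_neg,
      smul_neg]
    abel
  have hone_add := hasDerivAt_det_one_add_smul (-(T * R))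
  have hfactor_deriv : HasDerivAt (fun w : 𝕜 => LinearMap.det (1 + (w - z) • -(T * R)))
      (LinearMap.trace 𝕜 E (-(T * R))) z :=
    HasDerivAt.comp_sub_const z z (by simpa only [sub_self] using hone_add)
  rw [funext fun w => (congrArg LinearMap.det (hfactor w)).trans (map_mul _ _ _)]
  refine (hfactor_deriv.mul_const _).congr_deriv ?_
  rw [map_neg]
  ring

end Determinant

theorem hasDerivAt_inv_of_hasDerivAt_sq {𝕜 : Type*} [NontriviallyNormedField 𝕜] [NeZero (2 : 𝕜)]
    {r : 𝕜 → 𝕜} {z τ : 𝕜} (hr : DifferentiableAt 𝕜 r z) (hz : r z ≠ 0)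
    (hsq : HasDerivAt (fun w => r w ^ 2) (-(r z ^ 2 * τ)) z) :
    HasDerivAt (fun w => (r w)⁻¹) (1 / 2 * τ * (r z)⁻¹) z := by
  have h2 : (2 : 𝕜) ≠ 0 := two_ne_zero
  have hderiv : 2 * r z * deriv r z = -(r z ^ 2 * τ) := by
    simpa using (hr.hasDerivAt.fun_pow 2).unique hsq
  have hr' : deriv r z = -(1 / 2 * (r z * τ)) := by
    refine mul_left_cancel₀ (mul_ne_zero h2 hz) (hderiv.trans ?_)
    field_simp
  refine (hr.hasDerivAt.fun_inv hz).congr_deriv ?_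
  rw [hr']
  field_simp

section PositiveRealPart

variable {V : Type*} [NormedAddCommGroup V] [InnerProductSpace ℂ V]

theorem re_inner_one_sub_apply (T : V →L[ℂ] V) (v : V) :
    (⟪v, (1 - T) v⟫_ℂ).re = (‖v‖ ^ 2 - ‖T v‖ ^ 2 + ‖(1 - T) v‖ ^ 2) / 2 := by
  have h := re_inner_eq_norm_mul_self_add_norm_mul_self_sub_norm_sub_mul_self_div_two (𝕜 := ℂ)
    v ((1 - T) v)
  rw [show v - (1 - T) v = T v by simp, RCLike.re_eq_complex_re] at h
  rw [h]
  ring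

theorem one_sub_mem_posRe_of_injective {T : V →L[ℂ] V} (hT : ‖T‖ ≤ 1)
    (hinj : Function.Injective (1 - T : V →L[ℂ] V)) : 1 - T ∈ posRe V := by
  intro v hv
  have hpos : 0 < ‖(1 - T) v‖ := norm_pos_iff.2 ((map_ne_zero_iff (1 - T) hinj).2 hv)
  have hle : ‖T v‖ ≤ ‖v‖ := T.le_of_opNorm_le_of_le hT le_rfl |>.trans_eq (one_mul _)
  rw [re_inner_one_sub_apply]
  have hsq : ‖T v‖ ^ 2 ≤ ‖v‖ ^ 2 := by gcongr
  have hsq_pos : 0 < ‖(1 - T) v‖ ^ 2 := by positivity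
  linarith

theorem one_sub_mem_posRe_of_norm_lt_one {T : V →L[ℂ] V} (hT : ‖T‖ < 1) : 1 - T ∈ posRe V := by
  intro v hv
  have hlt : ‖T v‖ < ‖v‖ := (T.le_opNorm v).trans_lt (mul_lt_of_lt_one_left (norm_pos_iff.2 hv) hT)
  rw [re_inner_one_sub_apply]
  have hsq : ‖T v‖ ^ 2 < ‖v‖ ^ 2 := by gcongr
  have hsq_nonneg : 0 ≤ ‖(1 - T) v‖ ^ 2 := by positivity
  linarith

variable [FiniteDimensional ℂ V]

theorem isUnit_of_mem_posRe {T : V →L[ℂ] V} (hT : T ∈ posRe V) : IsUnit T := by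
  have := FiniteDimensional.complete ℂ V
  exact ContinuousLinearMap.isUnit_iff_isUnit_toLinearMap.2
    ((T : V →ₗ[ℂ] V).isUnit_iff_isUnit_det.2 (det_ne_zero_of_mem_posRe hT).isUnit)

theorem detSqrt_ne_zero {T : V →L[ℂ] V} (hT : T ∈ posRe V) : detSqrt V T ≠ 0 := by
  refine fun h => det_ne_zero_of_mem_posRe hT ?_
  rw [← isDetSqrt_detSqrt.sq_eq T hT, h, zero_pow two_ne_zero]

/-- The functional `S ↦ ½ tr(TS)`. Its value at the resolvent `(I - zT)⁻¹` is the logarithmic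
derivative of `Det^{1/2}(I - zT)⁻¹`. -/
def halfTraceMul (T : V →L[ℂ] V) : (V →L[ℂ] V) →L[ℂ] ℂ :=
  LinearMap.toContinuousLinearMap
    ((1 / 2 : ℂ) • LinearMap.trace ℂ V ∘ₗ ContinuousLinearMap.coeLM ℂ ∘ₗ LinearMap.mulLeft ℂ T)

theorem halfTraceMul_apply (T S : V →L[ℂ] V) :
    halfTraceMul T S = 1 / 2 * LinearMap.trace ℂ V (T * S : V →L[ℂ] V) := rfl

theorem hasDerivAt_inv_detSqrt_one_sub_smul {T : V →L[ℂ] V} {z : ℂ} (hz : 1 - z • T ∈ posRe V) :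
    HasDerivAt (fun w : ℂ => (detSqrt V (1 - w • T))⁻¹)
      (halfTraceMul T (Ring.inverse (1 - z • T)) * (detSqrt V (1 - z • T))⁻¹) z := by
  have hline : DifferentiableAt ℂ (fun w : ℂ => (1 - w • T : V →L[ℂ] V)) z := by fun_prop
  have hsqrt : DifferentiableAt ℂ (fun w : ℂ => detSqrt V (1 - w • T)) z :=
    DifferentiableAt.comp (g := detSqrt V) z
      (isDetSqrt_detSqrt.differentiableOn.differentiableAt (isOpen_posRe.mem_nhds hz)) hline
  have hsq : (fun w : ℂ => detSqrt V (1 - w • T) ^ 2) =ᶠ[𝓝 z]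
      fun w => LinearMap.det (1 - w • (T : Module.End ℂ V)) := by
    filter_upwards [hline.continuousAt.eventually (isOpen_posRe.mem_nhds hz)] with w hw
    exact isDetSqrt_detSqrt.sq_eq _ hw
  have hinv : ((Ring.inverse (1 - z • T) : V →L[ℂ] V) : Module.End ℂ V) *
      (1 - z • (T : Module.End ℂ V)) = 1 :=
    congrArg ContinuousLinearMap.toLinearMap (Ring.inverse_mul_cancel _ (isUnit_of_mem_posRe hz))
  have hdet := (hasDerivAt_det_one_sub_smul hinv).congr_of_eventuallyEq hsq
  have hsq_z : detSqrt V (1 - z • T) ^ 2 = LinearMap.det (1 - z • (T : Module.End ℂ V)) :=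
    hsq.self_of_nhds
  rw [← hsq_z] at hdet
  exact hasDerivAt_inv_of_hasDerivAt_sq hsqrt (detSqrt_ne_zero hz) hdet

theorem hasSum_inv_detSqrt_one_sub_smul {T : V →L[ℂ] V} {a : ℕ → ℂ} {z : ℂ} {R : ℝ}
    (hT : ∀ w ∈ Metric.ball (0 : ℂ) R, 1 - w • T ∈ posRe V) (h0 : a 0 = 1)
    (ha : ∀ n : ℕ, ((n : ℂ) + 1) * a (n + 1) =
      ∑ ij ∈ antidiagonal n, halfTraceMul T (T ^ ij.1) * a ij.2)
    (hz : z ∈ Metric.ball 0 R) :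
    HasSum (fun n => a n * z ^ n) (detSqrt V (1 - z • T))⁻¹ := by
  have := FiniteDimensional.complete ℂ V
  simpa only [sub_zero] using hasSum_of_hasDerivAt_mul
    (fun w hw => hasDerivAt_inv_detSqrt_one_sub_smul (hT w hw))
    (hasFPowerSeriesAt_clm_inverse_one_sub_smul (halfTraceMul T) T)
    (by simp [h0, isDetSqrt_detSqrt.map_one]) ha hz

end PositiveRealPart

section SymmetricAntilinear

variable {V : Type*} [NormedAddCommGroup V] [InnerProductSpace ℂ V] {X Y : V →L⋆[ℂ] V}

theorem IsSymmetric.inner_apply_comm (hX : IsSymmetric X) (x y : V) : ⟪X x, y⟫_ℂ = ⟪X y, x⟫_ℂ := by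
  rw [← inner_conj_symm, hX, inner_conj_symm]

theorem IsSymmetric.comp_comp_pow (hX : IsSymmetric X) (hY : IsSymmetric Y) (n : ℕ) :
    IsSymmetric (X.comp ((Y.comp X : V →L[ℂ] V) ^ n)) := by
  induction n with
  | zero => exact hX
  | succ n ih =>
    intro x y
    set S : V →L⋆[ℂ] V := X.comp ((Y.comp X : V →L[ℂ] V) ^ n) with hS
    have hleft : X.comp ((Y.comp X : V →L[ℂ] V) ^ (n + 1)) = S.comp (Y.comp X) := by
      ext v; simp [hS, pow_succ]
    have hright : X.comp ((Y.comp X : V →L[ℂ] V) ^ (n + 1)) = X.comp (Y.comp S) := by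
      ext v; simp [hS, pow_succ']
    calc ⟪y, X.comp ((Y.comp X : V →L[ℂ] V) ^ (n + 1)) x⟫_ℂ
        = ⟪y, S (Y (X x))⟫_ℂ := by rw [hleft]; rfl
      _ = ⟪Y (X x), S y⟫_ℂ := ih _ _
      _ = ⟪Y (S y), X x⟫_ℂ := hY.inner_apply_comm _ _
      _ = ⟪x, X (Y (S y))⟫_ℂ := hX _ _
      _ = ⟪x, X.comp ((Y.comp X : V →L[ℂ] V) ^ (n + 1)) y⟫_ℂ := by rw [hright]; rfl

theorem sum_inner_apply_apply {ι : Type*} [Fintype ι] (b : OrthonormalBasis ι ℂ V)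
    (hX : IsSymmetric X) (hY : IsSymmetric Y) :
    ∑ k, ⟪X (Y (b k)), b k⟫_ℂ = LinearMap.trace ℂ V (Y.comp X : V →L[ℂ] V) := by
  rw [LinearMap.trace_eq_sum_inner _ b]
  refine Finset.sum_congr rfl fun k _ => ?_
  rw [hX.inner_apply_comm]
  exact hY _ _

end SymmetricAntilinear

variable {V : Type*} [NormedAddCommGroup V] [InnerProductSpace ℂ V] [FiniteDimensional ℂ V]

section Annihilation

/-- The derivation of the symmetric algebra that annihilates the vector `x`: it is adjoint to
multiplication by `x` and sends `y ∈ V` to `⟨x | y⟩`. It is the transport of `annih x`, which acts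
on coordinates. -/
def annihilation (x : V) : Derivation ℂ (SymmetricAlgebra ℂ V) (SymmetricAlgebra ℂ V) :=
  Derivation.mk' ((coord V).symm.toLinearMap ∘ₗ (annih x : _ →ₗ[ℂ] _) ∘ₗ (coord V).toLinearMap)
    fun φ ψ => (coord V).injective (by simp)

theorem coord_annihilation (x : V) (φ : SymmetricAlgebra ℂ V) :
    coord V (annihilation x φ) = annih x (coord V φ) :=
  (coord V).apply_symm_apply _

theorem annihilation_ι (x y : V) :
    annihilation x (SymmetricAlgebra.ι ℂ V y) = algebraMap ℂ _ ⟪x, y⟫_ℂ :=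
  (coord V).injective (by rw [coord_annihilation, annih_ι, AlgEquiv.commutes])

theorem annihilation_ι_mul (x y : V) (φ : SymmetricAlgebra ℂ V) :
    annihilation x (SymmetricAlgebra.ι ℂ V y * φ) =
      ⟪x, y⟫_ℂ • φ + SymmetricAlgebra.ι ℂ V y * annihilation x φ := by
  rw [Derivation.leibniz, annihilation_ι, smul_eq_mul, smul_eq_mul, Algebra.smul_def,
    mul_comm φ, add_comm]

theorem symInner_ι_mul_left (x : V) (φ ψ : SymmetricAlgebra ℂ V) :
    symInner V (SymmetricAlgebra.ι ℂ V x * φ) ψ = symInner V φ (annihilation x ψ) := by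
  rw [symInner_ι_mul, ← coord_annihilation, ← symInner_apply]

theorem symInner_ι_mul_right (x : V) (φ ψ : SymmetricAlgebra ℂ V) :
    symInner V φ (SymmetricAlgebra.ι ℂ V x * ψ) = symInner V (annihilation x φ) ψ := by
  rw [← symInner_conj_symm, symInner_ι_mul_left, symInner_conj_symm]

theorem annihilation_quadratic {Z : V →L⋆[ℂ] V} (hZ : IsSymmetric Z) (x : V) :
    annihilation x (quadratic Z) = SymmetricAlgebra.ι ℂ V (Z x) := by
  set e := stdOrthonormalBasis ℂ V
  have hsum_left : ∑ k, ⟪x, e k⟫_ℂ • Z (e k) = Z x := by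
    conv_rhs => rw [← e.sum_repr' x]
    simp only [map_sum, map_smulₛₗ, inner_conj_symm]
  have hsum_right : ∑ k, ⟪x, Z (e k)⟫_ℂ • e k = Z x := by
    simp only [hZ _ x, e.sum_repr']
  have hterm : ∀ k, annihilation x (SymmetricAlgebra.ι ℂ V (e k) * SymmetricAlgebra.ι ℂ V (Z (e k)))
      = SymmetricAlgebra.ι ℂ V (⟪x, e k⟫_ℂ • Z (e k) + ⟪x, Z (e k)⟫_ℂ • e k) := fun k => by
    rw [annihilation_ι_mul, annihilation_ι, map_add, map_smul, map_smul, mul_comm,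
      ← Algebra.smul_def]
  rw [quadratic, Derivation.map_smul, map_sum, Finset.sum_congr rfl fun k _ => hterm k, ← map_sum,
    Finset.sum_add_distrib, hsum_left, hsum_right, ← two_smul ℂ, map_smul, smul_smul]
  norm_num

end Annihilation

section GaussianTerm

variable {X Y Z : V →L⋆[ℂ] V}

/-- The homogeneous component `ζⁿ / n!` of degree `2n` of the Gaussian `e^Z`. -/
def gaussianTerm (Z : V →L⋆[ℂ] V) (n : ℕ) : SymmetricAlgebra ℂ V :=
  (n.factorial : ℂ)⁻¹ • quadratic Z ^ n

theorem gaussianTerm_zero (Z : V →L⋆[ℂ] V) : gaussianTerm Z 0 = 1 := by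
  simp [gaussianTerm]

theorem gaussianTerm_mem (Z : V →L⋆[ℂ] V) (n : ℕ) : gaussianTerm Z n ∈ symPow V (2 * n) := by
  rw [symPow, pow_mul]
  exact Submodule.smul_mem _ _ (Submodule.pow_mem_pow _ (quadratic_mem Z) n)

theorem succ_smul_gaussianTerm_succ (Z : V →L⋆[ℂ] V) (n : ℕ) :
    ((n : ℂ) + 1) • gaussianTerm Z (n + 1) = quadratic Z * gaussianTerm Z n := by
  rw [gaussianTerm, gaussianTerm, smul_smul, mul_smul_comm, ← pow_succ', mul_comm,
    inv_factorial_succ_mul]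

theorem annihilation_gaussianTerm_succ (hZ : IsSymmetric Z) (x : V) (n : ℕ) :
    annihilation x (gaussianTerm Z (n + 1)) =
      SymmetricAlgebra.ι ℂ V (Z x) * gaussianTerm Z n := by
  rw [gaussianTerm, gaussianTerm, Derivation.map_smul, Derivation.leibniz_pow,
    annihilation_quadratic hZ, Nat.add_sub_cancel, ← Nat.cast_smul_eq_nsmul ℂ, smul_smul,
    Nat.cast_succ, inv_factorial_succ_mul, smul_eq_mul, mul_smul_comm, mul_comm]

theorem symInner_gaussianTerm_succ_ι_mul (hX : IsSymmetric X) (w : V) (n : ℕ)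
    (ψ : SymmetricAlgebra ℂ V) :
    symInner V (gaussianTerm X (n + 1)) (SymmetricAlgebra.ι ℂ V w * ψ) =
      symInner V (gaussianTerm X n) (annihilation (X w) ψ) := by
  rw [symInner_ι_mul_right, annihilation_gaussianTerm_succ hX, symInner_ι_mul_left]

-- Annihilating `X w` either removes `v` or turns `w` into `Y X w` while lowering both degrees.
theorem symInner_gaussianTerm_succ_ι_mul_ι_mul (hX : IsSymmetric X) (hY : IsSymmetric Y)
    (v w : V) (n : ℕ) :
    symInner V (gaussianTerm X (n + 1))
      (SymmetricAlgebra.ι ℂ V v * (SymmetricAlgebra.ι ℂ V w * gaussianTerm Y n)) =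
    ∑ ij ∈ antidiagonal n, ⟪X (((Y.comp X : V →L[ℂ] V) ^ ij.1) w), v⟫_ℂ *
      symInner V (gaussianTerm X ij.2) (gaussianTerm Y ij.2) := by
  induction n generalizing w with
  | zero =>
    rw [mul_left_comm, symInner_gaussianTerm_succ_ι_mul hX, annihilation_ι_mul]
    simp [gaussianTerm_zero]
  | succ n ih =>
    rw [mul_left_comm, symInner_gaussianTerm_succ_ι_mul hX, annihilation_ι_mul,
      annihilation_gaussianTerm_succ hY, map_add, map_smul, ih, Finset.Nat.sum_antidiagonal_succ]
    simp [pow_succ]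

theorem succ_mul_symInner_gaussianTerm_succ (hX : IsSymmetric X) (hY : IsSymmetric Y) (n : ℕ) :
    ((n : ℂ) + 1) * symInner V (gaussianTerm X (n + 1)) (gaussianTerm Y (n + 1)) =
      ∑ ij ∈ antidiagonal n, halfTraceMul (Y.comp X) ((Y.comp X : V →L[ℂ] V) ^ ij.1) *
        symInner V (gaussianTerm X ij.2) (gaussianTerm Y ij.2) := by
  have htrace : ∀ i : ℕ, ∑ k, ⟪X (((Y.comp X : V →L[ℂ] V) ^ i)
      (Y (stdOrthonormalBasis ℂ V k))), stdOrthonormalBasis ℂ V k⟫_ℂ =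
      LinearMap.trace ℂ V (Y.comp X * (Y.comp X) ^ i : V →L[ℂ] V) := fun i =>
    sum_inner_apply_apply (stdOrthonormalBasis ℂ V) (hX.comp_comp_pow hY i) hY
  rw [← smul_eq_mul, ← map_smul, succ_smul_gaussianTerm_succ, quadratic, smul_mul_assoc, map_smul,
    smul_eq_mul, Finset.sum_mul, map_sum]
  simp only [mul_assoc, symInner_gaussianTerm_succ_ι_mul_ι_mul hX hY]
  rw [Finset.sum_comm, Finset.mul_sum]
  refine Finset.sum_congr rfl fun ij _ => ?_
  rw [← Finset.sum_mul, htrace, halfTraceMul_apply, mul_assoc]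

end GaussianTerm

section Pairing

variable {X Y : V →L⋆[ℂ] V}

theorem component_eq_of_forall {Φ : Antidual V} {d : ℕ} {ψ : SymmetricAlgebra ℂ V}
    (hψ : ψ ∈ symPow V d) (h : ∀ θ ∈ symPow V d, Φ θ = symInner V θ ψ) : component Φ d = ψ := by
  by_contra hne
  have hmem : component Φ d - ψ ∈ symPow V d := Submodule.sub_mem _ (component_mem Φ d) hψ
  refine (symInner_self_pos (sub_ne_zero.2 hne)).ne' ?_
  rw [map_sub, ← component_spec Φ hmem, h _ hmem, sub_self, Complex.zero_re]

theorem gaussian_apply (Z : V →L⋆[ℂ] V) (θ : SymmetricAlgebra ℂ V) :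
    gaussian Z θ = ∑ᶠ n : ℕ, symInner V θ (gaussianTerm Z n) := rfl

theorem component_gaussian_two_mul (Z : V →L⋆[ℂ] V) (n : ℕ) :
    component (gaussian Z) (2 * n) = gaussianTerm Z n := by
  refine component_eq_of_forall (gaussianTerm_mem Z n) fun θ hθ => ?_
  rw [gaussian_apply, finsum_eq_single _ n]
  intro k hk
  exact symInner_of_mem_symPow (by lia) hθ (gaussianTerm_mem Z k)

theorem component_gaussian_of_odd (Z : V →L⋆[ℂ] V) {d : ℕ} (hd : Odd d) :
    component (gaussian Z) d = 0 := by
  refine component_eq_of_forall (Submodule.zero_mem _) fun θ hθ => ?_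
  rw [gaussian_apply, map_zero]
  refine finsum_eq_zero_of_forall_eq_zero fun k => ?_
  exact symInner_of_mem_symPow (by grind) hθ (gaussianTerm_mem Z k)

theorem hasPairingAt_gaussian {t : ℝ} {c : ℂ}
    (h : HasSum (fun n : ℕ => symInner V (gaussianTerm X n) (gaussianTerm Y n) *
      ((t : ℂ) ^ 4) ^ n) c) : HasPairingAt t (gaussian X) (gaussian Y) c := by
  refine HasSum.tendsto_sum_nat (f := fun d => symInner V (component (gaussian X) d)
    (component (gaussian Y) d) * (t : ℂ) ^ (2 * d)) ?_
  rw [← (mul_right_injective₀ (two_ne_zero (α := ℕ))).hasSum_iff]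
  · refine h.congr_fun fun n => ?_
    simp only [Function.comp_apply, component_gaussian_two_mul, ← pow_mul, ← mul_assoc,
      Nat.reduceMul]
  · intro d hd
    have hodd : Odd d := Nat.not_even_iff_odd.1 fun h =>
      hd (h.two_dvd.imp fun _ => Eq.symm)
    rw [component_gaussian_of_odd X hodd, map_zero, LinearMap.zero_apply, zero_mul]

theorem hasPairing_gaussian (hX : IsSymmetric X) (hY : IsSymmetric Y)
    (hball : ∀ z ∈ Metric.ball (0 : ℂ) 1, 1 - z • (Y.comp X : V →L[ℂ] V) ∈ posRe V)
    (hone : (1 - Y.comp X : V →L[ℂ] V) ∈ posRe V) :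
    HasPairing (gaussian X) (gaussian Y) (detSqrt V (1 - Y.comp X))⁻¹ := by
  set F : ℂ → ℂ := fun z => (detSqrt V (1 - z • Y.comp X))⁻¹
  have hF_one : F 1 = (detSqrt V (1 - Y.comp X))⁻¹ := by simp only [F, one_smul]
  have hF_cont : ContinuousAt F 1 :=
    (hasDerivAt_inv_detSqrt_one_sub_smul (by rwa [one_smul])).continuousAt
  refine ⟨fun t => F ((t : ℂ) ^ 4), fun t ht => ?_, ?_⟩
  · have ht4 : (t : ℂ) ^ 4 ∈ Metric.ball (0 : ℂ) 1 := by
      rw [mem_ball_zero_iff, norm_pow, Complex.norm_of_nonneg ht.1.le]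
      exact pow_lt_one₀ ht.1.le ht.2 four_ne_zero
    exact hasPairingAt_gaussian (hasSum_inv_detSqrt_one_sub_smul hball
      (by rw [gaussianTerm_zero, gaussianTerm_zero, symInner_one])
      (succ_mul_symInner_gaussianTerm_succ hX hY) ht4)
  · rw [← hF_one]
    refine hF_cont.tendsto.comp (Tendsto.mono_left ?_ nhdsWithin_le_nhds)
    exact Continuous.tendsto' (by fun_prop) _ _ (by simp)

end Pairing

end

end BosonicPairing

open BosonicPairing in
theorem theorem8_general {V : Type*} [NormedAddCommGroup V] [InnerProductSpace ℂ V]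
    [FiniteDimensional ℂ V] {X Y : V →L⋆[ℂ] V}
    (hX : IsSymmetric X) (hY : IsSymmetric Y)
    (hnorm : ‖(Y.comp X : V →L[ℂ] V)‖ ≤ 1) (hXY : IsUnit (1 - Y.comp X : V →L[ℂ] V)) :
    (1 - Y.comp X : V →L[ℂ] V) ∈ posRe V ∧
      HasPairing (gaussian X) (gaussian Y)
        (detSqrt V (1 - Y.comp X))⁻¹ := by
  have := FiniteDimensional.complete ℂ V
  have hone := one_sub_mem_posRe_of_injective hnorm
    (ContinuousLinearMap.isUnit_iff_bijective.1 hXY).injective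
  refine ⟨hone, hasPairing_gaussian hX hY (fun z hz => one_sub_mem_posRe_of_norm_lt_one ?_) hone⟩
  calc ‖z • (Y.comp X : V →L[ℂ] V)‖ ≤ ‖z‖ := by
        rw [norm_smul]
        exact mul_le_of_le_one_right (norm_nonneg z) hnorm
    _ < 1 := mem_ball_zero_iff.1 hz

theorem theorem8 {V : Type*} [NormedAddCommGroup V] [InnerProductSpace ℂ V]
    [FiniteDimensional ℂ V] (X Y : V →L⋆[ℂ] V)
    (hX : X ∈ BosonicPairing.closedSiegel V) (hY : Y ∈ BosonicPairing.closedSiegel V)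
    (hXY : IsUnit (1 - Y.comp X : V →L[ℂ] V)) :
    (1 - Y.comp X : V →L[ℂ] V) ∈ BosonicPairing.posRe V ∧
      BosonicPairing.HasPairing (BosonicPairing.gaussian X) (BosonicPairing.gaussian Y)
        (BosonicPairing.detSqrt V (1 - Y.comp X))⁻¹ :=
  theorem8_general hX.1 hY.1
    ((Y.opNorm_comp_le X).trans (mul_le_one₀ hY.2 (norm_nonneg X) hX.2)) hXY
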